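/- Let $A$ be a commutative Noetherian ring of finite Krull dimension $d$, with $d\neq 1$, and let $P$ be a finitely generated projective $A$-module of constant rank $d$. For a module $M$ over a commutative ring $R$, an element $m\in M$ is called unimodular if $\varphi(m)=1$ for some $\varphi\in M^*=\mathrm{Hom}_R(M,R)$, and $\mathrm{Um}(M)$ denotes the set of unimodular elements of $M$; put $\mathrm{Um}_n(R)=\mathrm{Um}(R^n)$. Let $E_n(R)$ be the subgroup of $\mathrm{SL}_n(R)$ generated by the elementary matrices $\mathrm{Id}+a e_{ij}$ with $a\in R$ and $i\neq j$, and let $E(M)$ be the subgroup of $\mathrm{Aut}_R(M)$ generated by the transvections $q\mapsto q+\varphi(q)p$, where $p\in M$ and $\varphi\in M^*$ satisfy $\varphi(p)=0$ and either $p\in\mathrm{Um}(M)$ or $\varphi\in\mathrm{Um}(M^*)$. Suppose that for every finite extension $R$ of $A$ (a commutative ring $R\supseteq A$ that is finitely generated as an $A$-module) the group $E_{d+1}(R)$ acts transitively on $\mathrm{Um}_{d+1}(R)$. Then $E(A\oplus P)$ acts transitively on $\mathrm{Um}(A\oplus P)$. -/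

import Mathlib

universe u v

/-- An element `m` of an `A`-module `M` is unimodular if some linear form takes the value `1` at
`m`. -/
def IsUnimodular (A : Type*) [CommRing A] {M : Type*} [AddCommGroup M] [Module A M] (m : M) :
    Prop :=
  ∃ φ : Module.Dual A M, φ m = 1

/-- `Um(M)`: the set of unimodular elements of `M`. In particular `Um_n(R)` is
`Um R (Fin n → R)`, the set of unimodular rows of length `n`. -/
def Um (A : Type*) [CommRing A] (M : Type*) [AddCommGroup M] [Module A M] : Set M :=
  {m | IsUnimodular A m}

/-- `E(M)`: the subgroup of `Aut(M)` generated by the transvections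
`q ↦ q + φ(q) p`, where `φ(p) = 0` and either `p` is unimodular in `M` or `φ` is unimodular in the
dual module of `M`. -/
def transvectionGroup (A : Type*) [CommRing A] (M : Type*) [AddCommGroup M] [Module A M] :
    Subgroup (M ≃ₗ[A] M) :=
  Subgroup.closure {e | ∃ (φ : Module.Dual A M) (p : M) (h : φ p = 0),
    (IsUnimodular A p ∨ IsUnimodular A φ) ∧ e = LinearEquiv.transvection h}

/-- `E_n(R)`: the group of elementary matrices, that is, the subgroup of `SL_n(R)` generated by
the matrices `Id + a e_{ij}` with `a ∈ R` and `i ≠ j`. -/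
def elementaryGroup (n : ℕ) (R : Type*) [CommRing R] :
    Subgroup (Matrix.SpecialLinearGroup (Fin n) R) :=
  Subgroup.closure {g | ∃ (i j : Fin n) (h : i ≠ j) (a : R),
    g = Matrix.SpecialLinearGroup.transvection h a}

/-- `E_n(R)` acts transitively (by right multiplication) on the unimodular rows of length `n`. -/
def ElementaryTransitive (n : ℕ) (R : Type*) [CommRing R] : Prop :=
  ∀ v ∈ Um R (Fin n → R), ∀ w ∈ Um R (Fin n → R),
    ∃ g ∈ elementaryGroup n R, Matrix.vecMul v (g : Matrix (Fin n) (Fin n) R) = w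

/-- `E(M)` acts transitively on `Um(M)`. -/
def TransvectionTransitive (A : Type*) [CommRing A] (M : Type*) [AddCommGroup M] [Module A M] :
    Prop :=
  ∀ v ∈ Um A M, ∀ w ∈ Um A M, ∃ e ∈ transvectionGroup A M, e v = w

/-! Let `d ≥ 2`. Some `s` outside all minimal primes makes `P` free after inversion: there are `α :
A^d → P` and `β : P → A^d` with both composites equal to `s`. As `dim A/(s³) < d`, Bass' theorem
modulo `s³` moves any unimodular element into the form `(1 + s³t, s³p)`. This is the image under `id
⊕ α` of the unimodular row `v = (1 + s³t, s²β(p))`, which is `(1, 0, …, 0)` modulo `s²`.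

The excision ring `A ×_{A/(s²)} A` is a finite extension of `A`. Transitivity over it moves `v` to
`(1, 0, …, 0)` by a matrix lying in every normal subgroup that contains the elementary matrices with
entry in `s²A` (`exists_mem_vecMul_eq_single_of_elementaryTransitive`). The normal core of the group
of matrices liftable to `E(A ⊕ P)` is such a subgroup: entries in `sA` lift
(`transvection_mem_liftableSubgroup`), and Suslin's normality argument absorbs conjugation at the
price of one more factor `s` (`transvection_mem_normalCore`). That argument needs size `d + 1 ≥ 3`.

If `d = 0`, then `P = 0` and `SL_1` is trivial, so the hypothesis for `R = A` leaves at most one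
unimodular element. -/

/-! ### Krull dimension of quotients and the stable range -/

theorem exists_notMem_mul_pow_mem_of_mem_minimalPrimes {A : Type*} [CommRing A] {I p : Ideal A}
    (hp : p ∈ I.minimalPrimes) {b : A} (hb : b ∈ p) : ∃ t ∉ p, ∃ k : ℕ, t * b ^ k ∈ I := by
  have := hp.1.1
  have h := IsLocalization.AtPrime.radical_map_of_mem_minimalPrimes (Localization.AtPrime p) p I hp
  have hb' : algebraMap A (Localization.AtPrime p) b ∈
      (I.map (algebraMap A (Localization.AtPrime p))).radical := by
    rw [h]; exact Ideal.mem_map_of_mem _ hb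
  obtain ⟨k, hk⟩ := hb'
  rw [← map_pow, IsLocalization.algebraMap_mem_map_algebraMap_iff p.primeCompl] at hk
  obtain ⟨t, ht, h⟩ := hk
  exact ⟨t, ht, k, h⟩

/-- A chain of primes over `J` extends downwards by a minimal prime of `I`, which cannot itself
contain `J`. -/
theorem ringKrullDim_quotient_add_one_le {A : Type*} [CommRing A] {I J : Ideal A} (hIJ : I ≤ J)
    (h : ∀ p ∈ I.minimalPrimes, ¬ J ≤ p) : ringKrullDim (A ⧸ J) + 1 ≤ ringKrullDim (A ⧸ I) := by
  by_cases hJ : J = ⊤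
  · have : Subsingleton (A ⧸ J) := Ideal.Quotient.subsingleton_iff.mpr hJ
    rw [ringKrullDim_eq_bot_of_subsingleton]
    simp
  have hn : ∀ K : Ideal A, K ≠ ⊤ → Nonempty (PrimeSpectrum.zeroLocus (R := A) K) := fun K hK ↦ by
    rwa [Set.nonempty_coe_sort, Set.nonempty_iff_ne_empty, ne_eq,
      PrimeSpectrum.zeroLocus_empty_iff_eq_top]
  have := hn J hJ
  have := hn I (fun hI ↦ hJ (top_le_iff.mp (hI ▸ hIJ)))
  rw [ringKrullDim_quotient, Order.krullDim_eq_iSup_length, ringKrullDim_quotient,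
    Order.krullDim_eq_iSup_length, ← WithBot.coe_one, ← WithBot.coe_add,
    ENat.iSup_add, WithBot.coe_le_coe, iSup_le_iff]
  intro l
  obtain ⟨p, hp, hp'⟩ := Ideal.exists_minimalPrimes_le
    (J := l.head.1.asIdeal) (hIJ.trans l.head.2)
  let p' : PrimeSpectrum.zeroLocus (R := A) I := ⟨⟨p, hp.1.1⟩, hp.1.2⟩
  let f : PrimeSpectrum.zeroLocus (R := A) J → PrimeSpectrum.zeroLocus (R := A) I :=
    fun q ↦ ⟨q.1, hIJ.trans q.2⟩
  have hf : StrictMono f := fun _ _ h ↦ h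
  have hlt : p' < (l.map f hf).head := lt_of_le_of_ne hp' fun e ↦ h p hp <| by
    have : p = l.head.1.asIdeal := congrArg (fun q ↦ q.1.asIdeal) e
    rw [this]; exact l.head.2
  refine le_trans ?_ (le_iSup _ ((l.map f hf).cons p' hlt))
  have : ((l.map f hf).cons p' hlt).length = l.length + 1 := RelSeries.cons_length ..
  rw [this]
  push_cast
  exact le_rfl

theorem ringKrullDim_quotient_lt {A : Type*} [CommRing A] {I J : Ideal A} (hIJ : I ≤ J)
    (h : ∀ p ∈ I.minimalPrimes, ¬ J ≤ p) {n : ℕ}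
    (hn : ringKrullDim (A ⧸ I) < (n + 1 : ℕ)) : ringKrullDim (A ⧸ J) < n := by
  have h1 := (ringKrullDim_quotient_add_one_le hIJ h).trans_lt hn
  by_contra! h2
  exact absurd ((add_le_add_left h2 1).trans_lt h1) (by push_cast; exact lt_irrefl _)

/-- The stable range theorem over a ring of finite Krull dimension, relative to an ideal. -/
theorem exists_forall_prime_mem_of_ringKrullDim_quotient_lt {A : Type*} [CommRing A] (a : A) :
    ∀ (n : ℕ) (I : Ideal A), ringKrullDim (A ⧸ I) < n → ∀ b : Fin n → A, ∃ x : Fin n → A,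
      ∀ p : Ideal A, p.IsPrime → I ≤ p → (∀ i, b i + a * x i ∈ p) → a ∈ p
  | 0, I, hI, b => ⟨0, fun p hp hIp _ ↦ by
      have : Nontrivial (A ⧸ I) :=
        Ideal.Quotient.nontrivial_iff.mpr fun h ↦ hp.ne_top (top_le_iff.mp (h ▸ hIp))
      exact absurd hI (not_lt.mpr (by exact_mod_cast ringKrullDim_nonneg_of_nontrivial))⟩
  | n + 1, I, hI, b => by
    -- `K = (√I : b_last)`. A minimal prime of `I` containing `b_last` misses some element of `K`,
    -- so adding `b_last` to `K` lowers the dimension.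
    let K : Ideal A := Submodule.comap (LinearMap.mulLeft A (b (Fin.last n))) I.radical
    have hK : ∀ {y}, y ∈ K ↔ b (Fin.last n) * y ∈ I.radical := Iff.rfl
    have hIK : I ≤ K := fun y hy ↦ hK.mpr (Ideal.mul_mem_left _ _ (Ideal.le_radical hy))
    let N : Ideal A := Ideal.span {b (Fin.last n)} ⊔ K
    have hN : ∀ p ∈ I.minimalPrimes, ¬ N ≤ p := by
      intro p hp hNp
      have hb : b (Fin.last n) ∈ p :=
        hNp (Ideal.mem_sup_left (Ideal.mem_span_singleton_self _))
      obtain ⟨t, ht, k, hk⟩ := exists_notMem_mul_pow_mem_of_mem_minimalPrimes hp hb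
      refine ht (hNp (Ideal.mem_sup_right (hK.mpr ⟨k + 1, ?_⟩)))
      have : (b (Fin.last n) * t) ^ (k + 1) = b (Fin.last n) * t ^ k * (t * b (Fin.last n) ^ k) := by
        ring
      rw [this]
      exact Ideal.mul_mem_left _ _ hk
    obtain ⟨x, hx⟩ := exists_forall_prime_mem_of_ringKrullDim_quotient_lt a n N
      (ringKrullDim_quotient_lt (hIK.trans le_sup_right) hN hI) (fun i ↦ b i.castSucc)
    have hrad : a ∈ (Ideal.span (Set.range fun i ↦ b i.castSucc + a * x i) ⊔ N).radical := by
      rw [Ideal.radical_eq_sInf, Ideal.mem_sInf]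
      rintro p ⟨hle, hp⟩
      exact hx p hp (le_sup_right.trans hle) fun i ↦
        hle (Ideal.mem_sup_left (Ideal.subset_span ⟨i, rfl⟩))
    obtain ⟨m, hm⟩ := hrad
    obtain ⟨e, he, z, hz, hez⟩ := Submodule.mem_sup.mp hm
    obtain ⟨c, hc, y, hy, rfl⟩ := Submodule.mem_sup.mp hz
    -- The last coordinate is the `K`-part `y` of `a ^ m`. Since `b_last * y` and `b_last + a * y`
    -- lie in `p`, either `a ∈ p` or both `b_last` and `y` do, and then `a ^ m ∈ p`.
    refine ⟨Fin.snoc x y, fun p hp hIp h ↦ ?_⟩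
    have he' : e ∈ p := by
      refine Ideal.span_le.mpr ?_ he
      rintro _ ⟨i, rfl⟩
      simpa using h i.castSucc
    have hlast : b (Fin.last n) + a * y ∈ p := by simpa using h (Fin.last n)
    have hby : b (Fin.last n) * y ∈ p := (hp.radical_le_iff.mpr hIp) (hK.mp hy)
    have key : b (Fin.last n) ∈ p → y ∈ p → a ∈ p := fun h1 h2 ↦ by
      refine hp.mem_of_pow_mem m ?_
      rw [← hez]
      refine add_mem he' (add_mem ?_ h2)
      exact (Ideal.span_singleton_le_iff_mem _).mpr h1 hc
    rcases hp.mem_or_mem hby with h1 | h1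
    · rcases hp.mem_or_mem ((Submodule.add_mem_iff_right p h1).mp hlast) with h2 | h2
      · exact h2
      · exact key h1 h2
    · exact key ((Submodule.add_mem_iff_left p (Ideal.mul_mem_left _ _ h1)).mp hlast) h1

/-! ### Freeness of `P` away from finitely many primes -/

-- Cayley–Hamilton for `e - t` gives a monic `f` with lower coefficients in `⨅ i, p i`. The shifted
-- polynomial `F = f(X - t)` kills `e`, and its constant term `f(-t)` is a power of `-t` modulo each
-- `p i`; dividing `F` by `X` gives the inverse of `e` up to that constant.
open Polynomial in
theorem exists_comp_eq_algebraMap_of_range_sub_le {A M ι : Type*} [CommRing A] [AddCommGroup M]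
    [Module A M] [Module.Finite A M] (p : ι → Ideal A) [hp : ∀ i, (p i).IsPrime]
    (e : Module.End A M) (t : A) (ht : ∀ i, t ∉ p i)
    (h : LinearMap.range (e - algebraMap A _ t) ≤ (⨅ i, p i) • (⊤ : Submodule A M)) :
    ∃ u : A, (∀ i, u ∉ p i) ∧ ∃ g : Module.End A M,
      e * g = algebraMap A _ u ∧ g * e = algebraMap A _ u := by
  obtain ⟨f, hf, -, hcoeff, hzero⟩ :=
    LinearMap.exists_monic_and_natDegree_eq_and_coeff_mem_pow_and_aeval_eq_zero _ _ _ h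
  have hfe : aeval e (f.comp (X - C t)) = 0 := by
    rw [aeval_comp]; simpa using hzero
  set F := f.comp (X - C t) with hF
  have h0 : F.coeff 0 = f.eval (-t) := by
    rw [coeff_zero_eq_eval_zero, hF, eval_comp]; simp
  refine ⟨F.coeff 0, fun i hi ↦ ?_, -aeval e F.divX, ?_, ?_⟩
  · rw [h0, eval_eq_sum_range, Finset.sum_range_succ, hf.coeff_natDegree, one_mul] at hi
    have : ∑ k ∈ Finset.range f.natDegree, f.coeff k * (-t) ^ k ∈ p i := by
      refine sum_mem fun k hk ↦ Ideal.mul_mem_right _ _ ?_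
      refine (Ideal.pow_le_self ?_).trans (iInf_le p i) (hcoeff k)
      have := Finset.mem_range.mp hk
      omega
    rw [Submodule.add_mem_iff_right _ this] at hi
    exact ht i (neg_mem_iff.mp ((hp i).mem_of_pow_mem _ hi))
  · have := congrArg (aeval e) (X_mul_divX_add F)
    rw [hfe, map_add, map_mul, aeval_X, aeval_C] at this
    rw [mul_neg, neg_eq_iff_add_eq_zero, this]
  · have := congrArg (aeval e) (divX_mul_X_add F)
    rw [hfe, map_add, map_mul, aeval_X, aeval_C] at this
    rw [neg_mul, neg_eq_iff_add_eq_zero, this]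

/-- The stalk at `p` is free of rank `d`; finite presentation lifts an isomorphism and its inverse
up to denominators. -/
theorem exists_notMem_comp_eq_smul_of_rankAtStalk_eq {A P : Type*} [CommRing A]
    [AddCommGroup P] [Module A P] [Module.Finite A P] [Module.Projective A P] {d : ℕ}
    (hrank : ∀ p : PrimeSpectrum A, Module.rankAtStalk (R := A) P p = d)
    (p : Ideal A) [hp : p.IsPrime] :
    ∃ s ∉ p, ∃ (α : (Fin d → A) →ₗ[A] P) (β : P →ₗ[A] (Fin d → A)),
      α ∘ₗ β = s • LinearMap.id ∧ β ∘ₗ α = s • LinearMap.id := by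
  have : Nontrivial A := ⟨0, 1, fun h ↦ hp.ne_top ((Ideal.eq_top_iff_one _).mpr (h ▸ p.zero_mem))⟩
  let S := p.primeCompl
  let f := LocalizedModule.mkLinearMap S P
  let g := LocalizedModule.mkLinearMap S (Fin d → A)
  have hfin : Module.finrank (Localization.AtPrime p) (LocalizedModule S (Fin d → A)) =
      Module.finrank (Localization.AtPrime p) (LocalizedModule S P) := by
    have h1 := hrank ⟨p, hp⟩
    have h2 := congrFun (Module.rankAtStalk_eq_finrank_of_free (R := A) (M := Fin d → A)) ⟨p, hp⟩
    rw [Module.rankAtStalk] at h1 h2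
    simp only [Pi.natCast_apply, Module.finrank_fin_fun] at h2
    exact h2.trans h1.symm
  have : Module.Free (Localization.AtPrime p) (LocalizedModule S P) :=
    Module.free_of_flat_of_isLocalRing
  have : Module.Free (Localization.AtPrime p) (LocalizedModule S (Fin d → A)) :=
    Module.free_of_flat_of_isLocalRing
  let e := (LinearEquiv.ofFinrankEq _ _ hfin).restrictScalars A
  have : Module.FinitePresentation A P := Module.finitePresentation_of_projective _ _
  obtain ⟨α, s₁, hα⟩ := Module.FinitePresentation.exists_lift_of_isLocalizedModule S f
    (e.toLinearMap ∘ₗ g)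
  obtain ⟨β, s₂, hβ⟩ := Module.FinitePresentation.exists_lift_of_isLocalizedModule S g
    (e.symm.toLinearMap ∘ₗ f)
  have hα' : ∀ x, f (α x) = s₁.1 • e (g x) := fun x ↦ LinearMap.congr_fun hα x
  have hβ' : ∀ x, g (β x) = s₂.1 • e.symm (f x) := fun x ↦ LinearMap.congr_fun hβ x
  obtain ⟨t₁, ht₁⟩ := Module.Finite.exists_smul_of_comp_eq_of_isLocalizedModule S f
    (α ∘ₗ β) ((s₁.1 * s₂.1) • LinearMap.id) (by
      ext x; simp [hα', hβ', mul_smul])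
  obtain ⟨t₂, ht₂⟩ := Module.Finite.exists_smul_of_comp_eq_of_isLocalizedModule S g
    (β ∘ₗ α) ((s₁.1 * s₂.1) • LinearMap.id) (by
      refine LinearMap.ext fun x ↦ ?_; simp [hα', hβ', mul_smul, smul_comm s₁.1])
  refine ⟨t₁ * t₂ * (s₁ * s₂), S.mul_mem (S.mul_mem t₁.2 t₂.2) (S.mul_mem s₁.2 s₂.2), α,
    (t₁.1 * t₂.1) • β, ?_, ?_⟩
  · have ht₁' : t₁.1 • (α ∘ₗ β) = t₁.1 • ((s₁.1 * s₂.1) • LinearMap.id) := ht₁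
    rw [LinearMap.comp_smul, mul_comm t₁.1, mul_smul, ht₁', smul_smul, smul_smul]
  · have ht₂' : t₂.1 • (β ∘ₗ α) = t₂.1 • ((s₁.1 * s₂.1) • LinearMap.id) := ht₂
    rw [LinearMap.smul_comp, mul_smul, ht₂', smul_smul, smul_smul]

theorem exists_mem_of_ne_and_notMem {A ι : Type*} [CommRing A] [Finite ι] (p : ι → Ideal A)
    [hp : ∀ i, (p i).IsPrime] (hinc : ∀ i j, p j ≤ p i → i = j) (i : ι) :
    ∃ c, c ∉ p i ∧ ∀ j, j ≠ i → c ∈ p j := by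
  classical
  have := Fintype.ofFinite ι
  have h : ∀ j, ∃ x, x ∉ p i ∧ (j ≠ i → x ∈ p j) := fun j ↦ by
    by_cases hj : j = i
    · exact ⟨1, (Ideal.ne_top_iff_one _).mp (hp i).ne_top, fun h ↦ absurd hj h⟩
    · obtain ⟨x, hx, hx'⟩ := Set.not_subset.mp fun hle ↦ hj (hinc i j hle).symm
      exact ⟨x, hx', fun _ ↦ hx⟩
  choose x hx hx' using h
  refine ⟨∏ j, x j, fun hmem ↦ ?_, fun j hj ↦ ?_⟩
  · obtain ⟨j, -, hj⟩ := (hp i).prod_mem_iff.mp hmem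
    exact hx j hj
  · exact Ideal.mem_of_dvd _ (Finset.dvd_prod_of_mem x (Finset.mem_univ j)) (hx' j hj)

/-- The cross terms carry `c i * c j` with `i ≠ j`, which lies in every `p k`. -/
theorem range_sum_smul_comp_sum_smul_sub_le {A M N ι : Type*} [CommRing A] [AddCommGroup M]
    [Module A M] [AddCommGroup N] [Module A N] [Fintype ι] (p : ι → Ideal A) (c s : ι → A)
    (hc : ∀ i j, j ≠ i → c i ∈ p j) (α : ι → M →ₗ[A] N) (β : ι → N →ₗ[A] M)
    (h : ∀ i, α i ∘ₗ β i = s i • LinearMap.id) :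
    LinearMap.range ((∑ i, c i • α i) ∘ₗ (∑ i, c i • β i) -
      algebraMap A (Module.End A N) (∑ i, c i * c i * s i)) ≤ (⨅ i, p i) • ⊤ := by
  classical
  rintro _ ⟨x, rfl⟩
  have h' : ∀ i, α i (β i x) = s i • x := fun i ↦ LinearMap.congr_fun (h i) x
  have : ((∑ i, c i • α i) ∘ₗ (∑ i, c i • β i) -
      algebraMap A (Module.End A N) (∑ i, c i * c i * s i)) x =
      ∑ i, ∑ j ∈ Finset.univ.erase i, (c j * c i) • α i (β j x) := by
    have h1 : ∀ i, ∑ j, (c j * c i) • α i (β j x) = (c i * c i * s i) • x +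
        ∑ j ∈ Finset.univ.erase i, (c j * c i) • α i (β j x) := fun i ↦ by
      rw [← Finset.add_sum_erase _ _ (Finset.mem_univ i), h', mul_smul (c i * c i)]
    simp only [LinearMap.sub_apply, LinearMap.comp_apply, LinearMap.sum_apply,
      LinearMap.smul_apply, map_sum, map_smul, Module.algebraMap_end_apply]
    simp only [Finset.smul_sum, smul_smul]
    rw [Finset.sum_comm]
    simp only [h1, Finset.sum_add_distrib]
    rw [add_sub_cancel_left]
  rw [this]
  refine sum_mem fun i _ ↦ sum_mem fun j hj ↦ Submodule.smul_mem_smul ?_ trivial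
  refine Ideal.mem_iInf.mpr fun k ↦ ?_
  by_cases hk : k = i
  · exact Ideal.mul_mem_right _ _ (hc j k (hk ▸ (Finset.ne_of_mem_erase hj).symm))
  · exact Ideal.mul_mem_left _ _ (hc i k hk)

/-- A projective module of constant rank `d` becomes free after inverting an element outside
finitely many given pairwise incomparable primes. -/
theorem exists_forall_notMem_comp_eq_smul_of_rankAtStalk_eq {A P ι : Type*} [CommRing A]
    [AddCommGroup P] [Module A P] [Module.Finite A P] [Module.Projective A P] {d : ℕ}
    (hrank : ∀ p : PrimeSpectrum A, Module.rankAtStalk (R := A) P p = d) [Finite ι]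
    (p : ι → Ideal A) [hp : ∀ i, (p i).IsPrime] (hinc : ∀ i j, p j ≤ p i → i = j) :
    ∃ s, (∀ i, s ∉ p i) ∧ ∃ (α : (Fin d → A) →ₗ[A] P) (β : P →ₗ[A] (Fin d → A)),
      (∀ x, α (β x) = s • x) ∧ ∀ x, β (α x) = s • x := by
  classical
  have := Fintype.ofFinite ι
  choose c hc hc' using exists_mem_of_ne_and_notMem p hinc
  choose s hs α β hαβ hβα using
    fun i ↦ exists_notMem_comp_eq_smul_of_rankAtStalk_eq (P := P) hrank (p i)
  have ht : ∀ i, ∑ j, c j * c j * s j ∉ p i := fun i h ↦ by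
    rw [← Finset.add_sum_erase _ _ (Finset.mem_univ i), Submodule.add_mem_iff_left] at h
    · rcases (hp i).mem_or_mem h with h | h
      · rcases (hp i).mem_or_mem h with h | h <;> exact hc i h
      · exact hs i h
    · exact sum_mem fun j hj ↦ Ideal.mul_mem_right _ _
        (Ideal.mul_mem_right _ _ (hc' j i (Finset.ne_of_mem_erase hj).symm))
  obtain ⟨u, hu, g, hg, -⟩ := exists_comp_eq_algebraMap_of_range_sub_le p _ _ ht
    (range_sum_smul_comp_sum_smul_sub_le p c s hc' α β hαβ)
  obtain ⟨v, hv, k, -, hk⟩ := exists_comp_eq_algebraMap_of_range_sub_le p _ _ ht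
    (range_sum_smul_comp_sum_smul_sub_le p c s hc' β α hβα)
  set a := ∑ i, c i • α i
  set b := ∑ i, c i • β i
  have hg' : ∀ x, a (b (g x)) = u • x := fun x ↦ LinearMap.congr_fun hg x
  have hk' : ∀ x, k (b (a x)) = v • x := fun x ↦ LinearMap.congr_fun hk x
  have hgk : ∀ x, v • b (g x) = u • k (b x) := fun x ↦ by
    rw [← hk' (b (g x)), hg', map_smul, map_smul]
  -- `g` is a right inverse of `a ∘ b` up to `u`, and `k` a left inverse of `b ∘ a` up to `v`; `hgk`
  -- compares the resulting one-sided inverses of `a`.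
  refine ⟨u * v, fun i h ↦ ((hp i).mem_or_mem h).elim (hu i) (hv i), a, u • k ∘ₗ b,
    fun x ↦ ?_, fun x ↦ ?_⟩
  · simp only [LinearMap.smul_apply, LinearMap.comp_apply]
    rw [← hgk, map_smul, hg', smul_smul, mul_comm]
  · simp only [LinearMap.smul_apply, LinearMap.comp_apply]
    rw [hk', smul_smul]

/-! ### Bass' theorem -/

/-- Bass' theorem, relative to an ideal `I`: if `P` has constant rank exceeding `dim A / I` and
`(a, p)` is unimodular, then some `p + a • q` is unimodular modulo `I`. -/
theorem exists_dual_apply_add_smul_sub_one_mem {A P : Type*} [CommRing A] [IsNoetherianRing A]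
    [AddCommGroup P] [Module A P] [Module.Finite A P] [Module.Projective A P] {d : ℕ}
    (hrank : ∀ p : PrimeSpectrum A, Module.rankAtStalk (R := A) P p = d) {a : A} {p : P}
    (h : (a, p) ∈ Um A (A × P)) : ∀ m ≤ d, ∀ I : Ideal A, ringKrullDim (A ⧸ I) < m →
      ∃ (q : P) (φ : Module.Dual A P), φ (p + a • q) - 1 ∈ I
  | 0, _, I, hI => ⟨0, 0, by
      have : I = ⊤ := by
        by_contra hne
        have : Nontrivial (A ⧸ I) := Ideal.Quotient.nontrivial_iff.mpr hne
        exact absurd hI (not_lt.mpr (by exact_mod_cast ringKrullDim_nonneg_of_nontrivial))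
      simp [this]⟩
  | m + 1, hm, I, hI => by
    have : Finite I.minimalPrimes := I.finite_minimalPrimes_of_isNoetherianRing
    have : ∀ i : I.minimalPrimes, i.1.IsPrime := fun i ↦ i.2.1.1
    obtain ⟨s, hs, α, β, -, hβα⟩ := exists_forall_notMem_comp_eq_smul_of_rankAtStalk_eq (P := P)
      hrank (fun i : I.minimalPrimes ↦ i.1)
      (fun i j hji ↦ Subtype.ext (le_antisymm (i.2.2 j.2.1 hji) hji))
    obtain ⟨q, φ, hφ⟩ := exists_dual_apply_add_smul_sub_one_mem hrank h m (by omega)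
      (I ⊔ Ideal.span {s}) (ringKrullDim_quotient_lt le_sup_left (fun p hp hle ↦ hs ⟨p, hp⟩
        (hle (Ideal.mem_sup_right (Ideal.mem_span_singleton_self s)))) hI)
    -- Correcting `q` by `s • α x` changes nothing modulo `s`, and `β` turns the correction into `a
    -- * s ^ 2` times `x`: one factor `s` is put in by hand, the other is `β ∘ α`.
    obtain ⟨x, hx⟩ := exists_forall_prime_mem_of_ringKrullDim_quotient_lt (a * s ^ 2) d I
      (hI.trans_le (by exact_mod_cast hm)) (β (p + a • q))
    set r := p + a • (q + s • α x) with hr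
    have hr' : r = p + a • q + (a * s) • α x := by rw [hr, smul_add, add_assoc, smul_smul]
    suffices htop : LinearMap.range (Module.Dual.eval A P r) ⊔ I = ⊤ by
      obtain ⟨_, ⟨ψ, rfl⟩, i, hi, hi'⟩ :=
        Submodule.mem_sup.mp ((Ideal.eq_top_iff_one _).mp htop)
      refine ⟨q + s • α x, ψ, ?_⟩
      rw [← hr, ← hi', Module.Dual.eval_apply, sub_add_cancel_left]
      exact neg_mem hi
    by_contra hne
    obtain ⟨𝔪, hmax, hle⟩ := Ideal.exists_le_maximal _ hne
    have hprime := hmax.isPrime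
    have hmem : ∀ ψ : Module.Dual A P, ψ r ∈ 𝔪 := fun ψ ↦ hle (Ideal.mem_sup_left ⟨ψ, rfl⟩)
    have hIle : I ≤ 𝔪 := le_sup_right.trans hle
    have hone : (1 : A) ∉ 𝔪 := (Ideal.ne_top_iff_one _).mp hmax.ne_top
    by_cases hs : s ∈ 𝔪
    · have h1 : φ (p + a • q) ∈ 𝔪 := by
        have := hmem φ
        rw [hr', map_add, map_smul, smul_eq_mul] at this
        exact (Submodule.add_mem_iff_left _
          (Ideal.mul_mem_right _ _ (Ideal.mul_mem_left _ _ hs))).mp this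
      have h2 : φ (p + a • q) - 1 ∈ 𝔪 :=
        sup_le hIle ((Ideal.span_singleton_le_iff_mem _).mpr hs) hφ
      exact hone ((Submodule.sub_mem_iff_right _ h1).mp h2)
    · have h1 : a * s ^ 2 ∈ 𝔪 := by
        refine hx 𝔪 hprime hIle fun i ↦ ?_
        have := hmem (LinearMap.proj i ∘ₗ β)
        rw [hr', LinearMap.comp_apply, map_add, map_smul, hβα, LinearMap.proj_apply] at this
        convert this using 1
        simp only [Pi.add_apply, Pi.smul_apply, smul_eq_mul]
        ring
      have ha : a ∈ 𝔪 := (hprime.mem_or_mem h1).resolve_right fun h ↦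
        hs (hprime.mem_of_pow_mem _ h)
      obtain ⟨ψ, hψ⟩ := h
      refine hone ?_
      have e : (a, p) = a • ((1 : A), -(q + s • α x)) + (0, r) := by
        refine Prod.ext (by simp) ?_
        simp only [hr, Prod.snd_add, Prod.smul_snd, smul_neg]
        abel
      rw [← hψ, e, map_add, map_smul]
      exact add_mem (Ideal.mul_mem_right _ _ ha) (hmem (ψ ∘ₗ LinearMap.inr A A P))

/-! ### Suslin's normality argument -/

open Matrix

section Matrices

variable {n A : Type*} [Fintype n] [DecidableEq n] [CommRing A]

theorem one_add_add_mem_of_mul_eq_zero {R : Type*} [Ring R] {S : Submonoid R} {x y : R}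
    (hx : 1 + x ∈ S) (hy : 1 + y ∈ S) (hxy : x * y = 0) : 1 + (x + y) ∈ S := by
  convert S.mul_mem hx hy using 1
  rw [mul_add, mul_one, add_mul, one_mul, hxy, add_zero, add_assoc]

theorem one_add_sum_mem_of_mul_eq_zero {R ι : Type*} [Ring R] {S : Submonoid R} {x : ι → R}
    (t : Finset ι) (hx : ∀ i ∈ t, 1 + x i ∈ S) (hxy : ∀ i ∈ t, ∀ j ∈ t, x i * x j = 0) :
    1 + ∑ i ∈ t, x i ∈ S := by
  classical
  induction t using Finset.induction_on with
  | empty => simp [S.one_mem]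
  | insert a t ha ih =>
    rw [Finset.sum_insert ha]
    refine one_add_add_mem_of_mul_eq_zero (hx a (Finset.mem_insert_self a t))
      (ih (fun i hi ↦ hx i (Finset.mem_insert_of_mem hi)) fun i hi j hj ↦
        hxy i (Finset.mem_insert_of_mem hi) j (Finset.mem_insert_of_mem hj)) ?_
    rw [Finset.mul_sum]
    exact Finset.sum_eq_zero fun i hi ↦
      hxy a (Finset.mem_insert_self a t) i (Finset.mem_insert_of_mem hi)

theorem one_add_mul_one_add_mul_one_sub_mul_one_sub {R : Type*} [Ring R] {x y : R}
    (hx : x * x = 0) (hy : y * y = 0) (hyx : y * x = 0) :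
    (1 + x) * (1 + y) * (1 + -x) * (1 + -y) = 1 + x * y := by
  have h : (1 + x) * (1 + y) * (1 + -x) * (1 + -y) = 1 + x * y - x * x - y * y - y * x
      - x * (y * x) - x * (y * y) + x * x * y + y * x * y + x * (y * x) * y := by noncomm_ring
  rw [h, hx, hy, hyx]
  simp

/-- The row `w j • e i - w i • e j`, which is orthogonal to `w`. -/
def koszulRow (w : n → A) (i j : n) : n → A := Pi.single i (w j) - Pi.single j (w i)

theorem koszulRow_dotProduct (w v : n → A) (i j : n) :
    koszulRow w i j ⬝ᵥ v = w j * v i - w i * v j := by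
  simp [koszulRow, sub_dotProduct]

/-- Exactness of the Koszul complex of a unimodular row: the sum is `(u ⬝ᵥ w) • ψ - (ψ ⬝ᵥ w) • u`.
-/
theorem sum_smul_koszulRow {w u ψ : n → A} (hu : u ⬝ᵥ w = 1) (hψ : ψ ⬝ᵥ w = 0) :
    ∑ k : n × n, (ψ k.1 * u k.2) • koszulRow w k.1 k.2 = ψ := by
  rw [Fintype.sum_prod_type]
  funext i
  simp only [koszulRow, Finset.sum_apply, Pi.smul_apply, Pi.sub_apply, smul_eq_mul, mul_sub,
    Finset.sum_sub_distrib, Pi.single_apply, mul_ite, mul_zero, Finset.sum_ite_eq,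
    Finset.mem_univ, if_true]
  have h1 : ∑ x, ∑ y, (if i = x then ψ x * u y * w y else 0) = ψ i := by
    rw [Finset.sum_comm]
    simp only [Finset.sum_ite_eq, Finset.mem_univ, if_true, mul_assoc]
    rw [← Finset.mul_sum]
    simp [← dotProduct.eq_1, hu]
  have h2 : ∑ x, ψ x * u i * w x = 0 := by
    have : ∑ x, ψ x * u i * w x = u i * (ψ ⬝ᵥ w) := by
      rw [dotProduct, Finset.mul_sum]
      exact Finset.sum_congr rfl fun x _ ↦ by ring
    rw [this, hψ, mul_zero]
  rw [h1, h2, sub_zero]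

variable {S : Submonoid (Matrix n n A)} {s : A}

theorem one_add_vecMulVec_single_left_mem
    (hS : ∀ i j, i ≠ j → ∀ c, 1 + Matrix.single i j (s * c) ∈ S) {k : n} {x : n → A}
    (hx : x k = 0) : 1 + vecMulVec (Pi.single k 1) (s • x) ∈ S := by
  have : vecMulVec (Pi.single k 1) (s • x) =
      ∑ j ∈ Finset.univ.erase k, Matrix.single k j (s * x j) := by
    ext i j
    rw [vecMulVec_apply, Matrix.sum_apply]
    by_cases hi : i = k
    · subst hi
      by_cases hj : j = i
      · subst hj
        simp [hx, Matrix.single_apply]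
      · simp [Matrix.single_apply, hj]
    · simp [hi, Ne.symm hi]
  rw [this]
  refine one_add_sum_mem_of_mul_eq_zero _
    (fun j hj ↦ hS k j (Finset.ne_of_mem_erase hj).symm _) fun i hi j _ ↦ ?_
  exact Matrix.single_mul_single_of_ne _ _ _ _ (Finset.ne_of_mem_erase hi) _

theorem one_add_vecMulVec_single_right_mem
    (hS : ∀ i j, i ≠ j → ∀ c, 1 + Matrix.single i j (s * c) ∈ S) {k : n} {x : n → A}
    (hx : x k = 0) : 1 + vecMulVec (s • x) (Pi.single k 1) ∈ S := by
  have : vecMulVec (s • x) (Pi.single k 1) =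
      ∑ j ∈ Finset.univ.erase k, Matrix.single j k (s * x j) := by
    ext j i
    rw [vecMulVec_apply, Matrix.sum_apply]
    by_cases hi : i = k
    · subst hi
      by_cases hj : j = i
      · subst hj
        simp [hx, Matrix.single_apply]
      · simp [Matrix.single_apply, hj]
    · simp [hi, Ne.symm hi]
  rw [this]
  refine one_add_sum_mem_of_mul_eq_zero _
    (fun j hj ↦ hS j k (Finset.ne_of_mem_erase hj) _) fun i _ j hj ↦ ?_
  exact Matrix.single_mul_single_of_ne _ _ _ _ (Finset.ne_of_mem_erase hj).symm _

/-- Split `w` into its part `w'` on `{i, j}` and the rest. The rest contributes elementary rows. The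
part `w'` is orthogonal to the Koszul row, and with a third index `k` it contributes a commutator of
a column and a row through `k`; each has a factor `s`, hence `s ^ 2`. -/
theorem one_add_vecMulVec_koszulRow_mem
    (hS : ∀ i j, i ≠ j → ∀ c, 1 + Matrix.single i j (s * c) ∈ S)
    (hn : ∀ i j : n, ∃ k, k ≠ i ∧ k ≠ j) (w : n → A) (z : A) {i j : n} (hij : i ≠ j) :
    1 + vecMulVec w ((s ^ 2 * z) • koszulRow w i j) ∈ S := by
  obtain ⟨k, hki, hkj⟩ := hn i j
  set ρ := koszulRow w i j with hρ
  have hρl : ∀ l, l ≠ i → l ≠ j → ρ l = 0 := fun l hi hj ↦ by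
    simp [hρ, koszulRow, hi, hj]
  set w' : n → A := Pi.single i (w i) + Pi.single j (w j) with hw'
  have hw'i : w' i = w i := by simp [hw', hij]
  have hw'j : w' j = w j := by simp [hw', hij.symm]
  have hw'k : w' k = 0 := by simp [hw', hki, hkj]
  have hw : w = w' + ∑ l ∈ Finset.univ.filter (fun l ↦ l ≠ i ∧ l ≠ j),
      w l • (Pi.single l 1 : n → A) := by
    funext m
    rw [Pi.add_apply, Finset.sum_apply]
    simp only [Pi.smul_apply, smul_eq_mul, Pi.single_apply, mul_ite, mul_one, mul_zero,
      Finset.sum_ite_eq, Finset.mem_filter, Finset.mem_univ, true_and]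
    by_cases hmi : m = i
    · subst hmi; simp [hw'i]
    · by_cases hmj : m = j
      · subst hmj; simp [hw'j]
      · simp [hmi, hmj, hw']
  have hρw' : ρ ⬝ᵥ w' = 0 := by
    rw [hρ, koszulRow_dotProduct, hw'i, hw'j]; ring
  have hdecomp : vecMulVec w ((s ^ 2 * z) • ρ) = vecMulVec w' ((s ^ 2 * z) • ρ) +
      ∑ l ∈ Finset.univ.filter (fun l ↦ l ≠ i ∧ l ≠ j),
        vecMulVec (Pi.single l 1) (s • (s * z * w l) • ρ) := by
    ext a b
    conv_lhs => rw [hw]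
    simp only [vecMulVec_apply, Matrix.add_apply, Matrix.sum_apply, Pi.add_apply, add_mul,
      Finset.sum_apply, Finset.sum_mul, Pi.smul_apply, smul_eq_mul]
    congr 1
    exact Finset.sum_congr rfl fun l _ ↦ by ring
  rw [hdecomp]
  refine one_add_add_mem_of_mul_eq_zero ?_ ?_ ?_
  · have hX : ∀ y : n → A, y k = 0 → 1 + vecMulVec (s • y) (Pi.single k 1) ∈ S :=
      fun y hy ↦ one_add_vecMulVec_single_right_mem hS hy
    have hY : ∀ y : n → A, y k = 0 → 1 + vecMulVec (Pi.single k 1) (s • y) ∈ S :=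
      fun y hy ↦ one_add_vecMulVec_single_left_mem hS hy
    have hρk := hρl k hki hkj
    have key := one_add_mul_one_add_mul_one_sub_mul_one_sub
      (x := vecMulVec (s • w') (Pi.single k 1)) (y := vecMulVec (Pi.single k 1) (s • z • ρ))
      (by rw [vecMulVec_mul_vecMulVec]; simp [hw'k])
      (by rw [vecMulVec_mul_vecMulVec]; simp [hρk])
      (by rw [vecMulVec_mul_vecMulVec]; simp [hρw'])
    have hprod : vecMulVec (s • w') (Pi.single k 1) * vecMulVec (Pi.single k 1) (s • z • ρ) =
        vecMulVec w' ((s ^ 2 * z) • ρ) := by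
      rw [vecMulVec_mul_vecMulVec]
      ext a b
      simp [vecMulVec_apply]
      ring
    rw [hprod] at key
    rw [← key]
    refine S.mul_mem (S.mul_mem (S.mul_mem (hX _ hw'k) (hY _ (by simp [hρk]))) ?_) ?_
    · rw [← neg_vecMulVec, ← smul_neg]
      exact hX _ (by simp [hw'k])
    · rw [← vecMulVec_neg, ← smul_neg]
      exact hY _ (by simp [hρk])
  · refine one_add_sum_mem_of_mul_eq_zero _ (fun l hl ↦ ?_) fun l hl m hm ↦ ?_
    · have := (Finset.mem_filter.mp hl).2
      exact one_add_vecMulVec_single_left_mem hS (by simp [hρl l this.1 this.2])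
    · have := (Finset.mem_filter.mp hm).2
      rw [vecMulVec_mul_vecMulVec]
      simp [hρl m this.1 this.2]
  · rw [Finset.mul_sum]
    refine Finset.sum_eq_zero fun m hm ↦ ?_
    have := (Finset.mem_filter.mp hm).2
    rw [vecMulVec_mul_vecMulVec]
    simp [hρl m this.1 this.2]

theorem one_add_vecMulVec_mem_of_dotProduct_eq_zero
    (hS : ∀ i j, i ≠ j → ∀ c, 1 + Matrix.single i j (s * c) ∈ S)
    (hn : ∀ i j : n, ∃ k, k ≠ i ∧ k ≠ j) {w u ψ : n → A} (hu : u ⬝ᵥ w = 1) (hψ : ψ ⬝ᵥ w = 0)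
    (z : A) : 1 + vecMulVec w ((s ^ 2 * z) • ψ) ∈ S := by
  have : vecMulVec w ((s ^ 2 * z) • ψ) = ∑ k : n × n,
      vecMulVec w ((s ^ 2 * (z * (ψ k.1 * u k.2))) • koszulRow w k.1 k.2) := by
    conv_lhs => rw [← sum_smul_koszulRow hu hψ]
    ext a b
    simp only [vecMulVec_apply, Matrix.sum_apply, Pi.smul_apply, Finset.sum_apply, smul_eq_mul,
      Finset.mul_sum]
    exact Finset.sum_congr rfl fun l _ ↦ by ring
  rw [this]
  refine one_add_sum_mem_of_mul_eq_zero _ (fun k _ ↦ ?_) fun k _ l _ ↦ ?_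
  · by_cases hk : k.1 = k.2
    · have : koszulRow w k.1 k.2 = 0 := by rw [hk]; simp [koszulRow]
      rw [this, smul_zero, vecMulVec_zero, add_zero]
      exact S.one_mem
    · exact one_add_vecMulVec_koszulRow_mem hS hn w _ hk
  · rw [vecMulVec_mul_vecMulVec]
    simp [koszulRow_dotProduct, mul_comm]

/-- If a subgroup of `SL_n(A)`, `n ≥ 3`, contains all elementary matrices with entry in `sA`, then
it contains all conjugates of the elementary matrices with entry in `s²A`. -/
theorem transvection_mem_normalCore {H : Subgroup (SpecialLinearGroup n A)}
    (hH : ∀ i j (h : i ≠ j) (c : A), SpecialLinearGroup.transvection h (s * c) ∈ H)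
    (hn : ∀ i j : n, ∃ k, k ≠ i ∧ k ≠ j) {i j : n} (hij : i ≠ j) (z : A) :
    SpecialLinearGroup.transvection hij (s ^ 2 * z) ∈ H.normalCore := by
  intro γ
  let S : Submonoid (Matrix n n A) := H.toSubmonoid.map SpecialLinearGroup.coeMonoidHom
  have hS : ∀ i j, i ≠ j → ∀ c, 1 + Matrix.single i j (s * c) ∈ S := fun i j h c ↦
    ⟨_, hH i j h c, rfl⟩
  set g := SpecialLinearGroup.coeMonoidHom γ with hg
  set g' := SpecialLinearGroup.coeMonoidHom γ⁻¹ with hg'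
  have hgg : g' * g = 1 := by
    rw [hg, hg', ← map_mul, inv_mul_cancel, map_one]
  have hdot : ∀ k l, (Pi.single k 1 ᵥ* g') ⬝ᵥ (g *ᵥ Pi.single l 1) = (1 : Matrix n n A) k l := by
    intro k l
    rw [dotProduct_mulVec, vecMul_vecMul, hgg]
    simp [Matrix.one_apply, Pi.single_apply, eq_comm]
  -- The conjugate is `1 + s²z (γ e_i)(e_jᵀ γ⁻¹)`: its row is orthogonal to its column, and `e_iᵀ
  -- γ⁻¹` witnesses that the column is unimodular.
  obtain ⟨h, hh, hh'⟩ := one_add_vecMulVec_mem_of_dotProduct_eq_zero hS hn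
    (w := g *ᵥ Pi.single i 1) (u := Pi.single i 1 ᵥ* g') (ψ := Pi.single j 1 ᵥ* g')
    (by rw [hdot, Matrix.one_apply_eq]) (by rw [hdot, Matrix.one_apply_ne hij.symm]) z
  have : h = γ * SpecialLinearGroup.transvection hij (s ^ 2 * z) * γ⁻¹ := by
    apply SpecialLinearGroup.coeMonoidHom_injective
    have hsingle : SpecialLinearGroup.coeMonoidHom
        (SpecialLinearGroup.transvection hij (s ^ 2 * z)) =
        1 + vecMulVec (Pi.single i 1) ((s ^ 2 * z) • Pi.single j 1) := by
      rw [vecMulVec_smul, ← single_eq_single_vecMulVec_single, Matrix.smul_single, smul_eq_mul,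
        mul_one]
      rfl
    rw [hh', map_mul, map_mul, hsingle, ← hg, ← hg', mul_add, mul_one, add_mul,
      mul_eq_one_comm.mp hgg, mul_vecMulVec, vecMulVec_mul, smul_vecMul]
  rw [← this]
  exact hh

end Matrices

/-! ### Excision -/

theorem mem_Um_pi_iff {n A : Type*} [Fintype n] [CommRing A] {v : n → A} :
    v ∈ Um A (n → A) ↔ ∃ c : n → A, c ⬝ᵥ v = 1 := by
  classical
  constructor
  · rintro ⟨φ, hφ⟩
    refine ⟨fun i ↦ φ (Pi.single i 1), ?_⟩
    rw [LinearMap.pi_apply_eq_sum_univ φ v] at hφ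
    refine Eq.trans (Finset.sum_congr rfl fun i _ ↦ ?_) hφ
    rw [smul_eq_mul, mul_comm]
    congr 1
    refine congrArg φ (funext fun j ↦ ?_)
    simp [Pi.single_apply, eq_comm]
  · rintro ⟨c, hc⟩
    exact ⟨∑ i, c i • LinearMap.proj i, by simpa [dotProduct] using hc⟩

/-- The excision ring `A ×_{A/J} A` of an ideal `J`. -/
def excisionRing {A : Type*} [CommRing A] (J : Ideal A) : Subalgebra A (A × A) :=
  AlgHom.equalizer ((Ideal.Quotient.mkₐ A J).comp (AlgHom.fst A A A))
    ((Ideal.Quotient.mkₐ A J).comp (AlgHom.snd A A A))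

theorem mem_excisionRing {A : Type*} [CommRing A] {J : Ideal A} {x : A × A} :
    x ∈ excisionRing J ↔ x.1 - x.2 ∈ J :=
  (Ideal.Quotient.mk_eq_mk_iff_sub_mem (I := J) x.1 x.2)

/-- Excision: if the elementary group of `A ×_{A/J} A` acts transitively on unimodular rows, then
every unimodular row congruent to `(1, 0, …, 0)` modulo `J` is moved to `(1, 0, …, 0)` by any normal
subgroup containing the elementary matrices with entry in `J`. -/
theorem exists_mem_vecMul_eq_single_of_elementaryTransitive {A : Type*} [CommRing A] {J : Ideal A}
    {n : ℕ} (hE : ElementaryTransitive (n + 1) (excisionRing J))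
    {N : Subgroup (SpecialLinearGroup (Fin (n + 1)) A)} [N.Normal]
    (hN : ∀ i j (h : i ≠ j), ∀ c ∈ J, SpecialLinearGroup.transvection h c ∈ N)
    {v : Fin (n + 1) → A} (hv : v ∈ Um A (Fin (n + 1) → A))
    (hvJ : ∀ i, v i - (Pi.single 0 1 : Fin (n + 1) → A) i ∈ J) :
    ∃ g ∈ N, v ᵥ* (SpecialLinearGroup.coeMonoidHom g) = Pi.single 0 1 := by
  let π₁ : excisionRing J →+* A := (RingHom.fst A A).comp (excisionRing J).val.toRingHom
  let π₂ : excisionRing J →+* A := (RingHom.snd A A).comp (excisionRing J).val.toRingHom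
  have hext : ∀ x y : excisionRing J, π₁ x = π₁ y → π₂ x = π₂ y → x = y :=
    fun x y h1 h2 ↦ Subtype.ext (Prod.ext h1 h2)
  let w : Fin (n + 1) → excisionRing J :=
    fun i ↦ ⟨(v i, (Pi.single 0 1 : Fin (n + 1) → A) i), mem_excisionRing.mpr (hvJ i)⟩
  have hw1 : π₁ ∘ w = v := rfl
  have hw2 : π₂ ∘ w = Pi.single 0 1 := rfl
  have hw : w ∈ Um (excisionRing J) (Fin (n + 1) → excisionRing J) := by
    obtain ⟨c, hc⟩ := mem_Um_pi_iff.mp hv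
    have hc0 : c 0 - 1 ∈ J := by
      have h1 : ∑ i, c i * (v i - (Pi.single 0 1 : Fin (n + 1) → A) i) ∈ J :=
        sum_mem fun i _ ↦ Ideal.mul_mem_left _ _ (hvJ i)
      have h2 : ∑ i, c i * (v i - (Pi.single 0 1 : Fin (n + 1) → A) i) = 1 - c 0 := by
        simp only [mul_sub, Finset.sum_sub_distrib]
        congr 1
        simp [Pi.single_apply]
      rw [h2] at h1
      rw [← neg_sub]
      exact neg_mem h1
    -- Replacing `c 0` by `1` in the second component is allowed because `c 0 ≡ 1` modulo `J`.
    have hmem : ∀ i, (c i, Function.update c 0 1 i) ∈ excisionRing J := fun i ↦ by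
      rw [mem_excisionRing]
      by_cases hi : i = 0
      · subst hi; simpa using hc0
      · simp [hi]
    refine mem_Um_pi_iff.mpr ⟨fun i ↦ ⟨_, hmem i⟩, hext _ _ ?_ ?_⟩
    · rw [RingHom.map_dotProduct, map_one]
      exact hc
    · rw [RingHom.map_dotProduct, map_one, hw2]
      refine (dotProduct_single_one _ _).trans ?_
      exact Function.update_self (0 : Fin (n + 1)) (1 : A) c
  have h1 : (Pi.single 0 1 : Fin (n + 1) → excisionRing J) ∈
      Um (excisionRing J) (Fin (n + 1) → excisionRing J) :=
    mem_Um_pi_iff.mpr ⟨(Pi.single 0 1 : Fin (n + 1) → excisionRing J), by simp⟩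
  obtain ⟨g, hg, hgw⟩ := hE w hw _ h1
  have heq : Set.EqOn ((QuotientGroup.mk' N).comp (SpecialLinearGroup.map π₁))
      ((QuotientGroup.mk' N).comp (SpecialLinearGroup.map π₂)) (elementaryGroup (n + 1) (excisionRing J) : Set _) := by
    refine MonoidHom.eqOn_closure ?_
    rintro _ ⟨i, j, hij, a, rfl⟩
    have hmap : ∀ π : excisionRing J →+* A,
        SpecialLinearGroup.map π (SpecialLinearGroup.transvection hij a) =
          SpecialLinearGroup.transvection hij (π a) := fun π ↦ by
      apply SpecialLinearGroup.coeMonoidHom_injective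
      ext k l
      change π ((1 : Matrix _ _ _) k l + Matrix.single i j a k l) =
        (1 : Matrix _ _ _) k l + Matrix.single i j (π a) k l
      simp [Matrix.one_apply, Matrix.single_apply, apply_ite π]
    rw [MonoidHom.comp_apply, MonoidHom.comp_apply, hmap, hmap]
    refine (QuotientGroup.eq (s := N)).mpr ?_
    rw [SpecialLinearGroup.transvection_inv, ← SpecialLinearGroup.transvection_add]
    refine hN i j hij _ ?_
    rw [neg_add_eq_sub, ← neg_sub]
    exact neg_mem (mem_excisionRing.mp a.2)
  have hmemN := (QuotientGroup.eq (s := N)).mp (heq hg).symm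
  have hvec : ∀ π : excisionRing J →+* A, (π ∘ w) ᵥ*
      SpecialLinearGroup.coeMonoidHom (SpecialLinearGroup.map π g) = Pi.single 0 1 := fun π ↦ by
    have h : π ∘ (w ᵥ* SpecialLinearGroup.coeMonoidHom g) = π ∘ Pi.single 0 1 :=
      congrArg (π ∘ ·) hgw
    have h' : (π ∘ Pi.single 0 1 : Fin (n + 1) → A) = Pi.single 0 1 := by
      ext i
      simp [Pi.single_apply, apply_ite π]
    rw [h'] at h
    rw [← h]
    ext i
    exact (RingHom.map_vecMul π _ w i).symm
  -- The matrix is `π₁(g) π₂(g)⁻¹`: `π₁(g)` takes `v` to `(1, 0, …, 0)`, and `π₂(g)` fixes that row.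
  refine ⟨_, ‹N.Normal›.mem_comm hmemN, ?_⟩
  have e1 := hvec π₁
  have e2 := hvec π₂
  rw [hw1] at e1
  rw [hw2] at e2
  rw [map_mul, ← vecMul_vecMul, e1]
  conv_lhs => rw [← e2]
  rw [vecMul_vecMul, ← map_mul, mul_inv_cancel, map_one, vecMul_one]

/-! ### Lifting elementary matrices to `E(A ⊕ P)` -/

/-- The matrices whose action on rows lifts along `f` to an element of `E(M)`. -/
def liftableSubgroup {n A M : Type*} [Fintype n] [DecidableEq n] [CommRing A] [AddCommGroup M]
    [Module A M] (f : (n → A) →ₗ[A] M) : Subgroup (SpecialLinearGroup n A) where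
  carrier := {g | ∃ e ∈ transvectionGroup A M, ∀ v,
    e (f v) = f (v ᵥ* SpecialLinearGroup.coeMonoidHom g)}
  one_mem' := ⟨1, one_mem _, fun v ↦ by rw [map_one, vecMul_one]; rfl⟩
  mul_mem' := by
    rintro g h ⟨e, he, heg⟩ ⟨e', he', heh⟩
    refine ⟨e' * e, mul_mem he' he, fun v ↦ ?_⟩
    rw [map_mul, ← vecMul_vecMul, ← heh, ← heg]
    rfl
  inv_mem' := by
    rintro g ⟨e, he, heg⟩
    refine ⟨e⁻¹, inv_mem he, fun v ↦ e.injective ?_⟩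
    rw [heg, vecMul_vecMul, ← map_mul, inv_mul_cancel, map_one, vecMul_one]
    exact e.apply_symm_apply _

section Product

variable {A P : Type*} [CommRing A] [AddCommGroup P] [Module A P]

theorem exists_mem_transvectionGroup_add_smul (q : P) :
    ∃ e ∈ transvectionGroup A (A × P), ∀ m : A × P, e m = (m.1, m.2 + m.1 • q) := by
  have h : LinearMap.fst A A P (0, q) = 0 := rfl
  refine ⟨LinearEquiv.transvection h, Subgroup.subset_closure
    ⟨_, _, h, Or.inr ⟨Module.Dual.eval A _ (1, 0), rfl⟩, rfl⟩, fun m ↦ ?_⟩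
  rw [LinearEquiv.transvection.apply]
  ext <;> simp

theorem exists_mem_transvectionGroup_add_apply (φ : Module.Dual A P) :
    ∃ e ∈ transvectionGroup A (A × P), ∀ m : A × P, e m = (m.1 + φ m.2, m.2) := by
  have h : (φ ∘ₗ LinearMap.snd A A P) (1, 0) = 0 := by simp
  refine ⟨LinearEquiv.transvection h, Subgroup.subset_closure
    ⟨_, _, h, Or.inl ⟨LinearMap.fst A A P, rfl⟩, rfl⟩, fun m ↦ ?_⟩
  rw [LinearEquiv.transvection.apply]
  ext <;> simp

/-- The map `A ⊕ A^d → A ⊕ P` induced by a map `A^d → P`. -/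
def rowMap {d : ℕ} (α : (Fin d → A) →ₗ[A] P) : (Fin (d + 1) → A) →ₗ[A] A × P :=
  (LinearMap.proj 0).prod (α ∘ₗ LinearMap.funLeft A A Fin.succ)

theorem rowMap_apply {d : ℕ} (α : (Fin d → A) →ₗ[A] P) (v : Fin (d + 1) → A) :
    rowMap α v = (v 0, α fun i ↦ v i.succ) := rfl

theorem coeMonoidHom_transvection {n : Type*} [Fintype n] [DecidableEq n] {i j : n}
    (h : i ≠ j) (c : A) :
    SpecialLinearGroup.coeMonoidHom (SpecialLinearGroup.transvection h c) =
      1 + Matrix.single i j c := rfl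

theorem vecMul_coeMonoidHom_transvection {n : Type*} [Fintype n] [DecidableEq n] {i j : n}
    (h : i ≠ j) (c : A) (v : n → A) :
    v ᵥ* SpecialLinearGroup.coeMonoidHom (SpecialLinearGroup.transvection h c) =
      v + Pi.single j (v i * c) := by
  rw [coeMonoidHom_transvection, vecMul_add, vecMul_one]
  congr 1
  ext k
  simp only [vecMul, dotProduct, Matrix.single_apply, Pi.single_apply]
  by_cases hk : k = j
  · subst hk; simp
  · simp [hk, Ne.symm hk]

theorem transvection_mem_liftableSubgroup {d : ℕ} {s : A} {α : (Fin d → A) →ₗ[A] P}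
    {β : P →ₗ[A] (Fin d → A)} (hβα : ∀ x, β (α x) = s • x) {i j : Fin (d + 1)} (h : i ≠ j)
    (c : A) : SpecialLinearGroup.transvection h (s * c) ∈ liftableSubgroup (rowMap α) := by
  have hrow : ∀ (k : Fin d) (hk : (0 : Fin (d + 1)) ≠ k.succ) (c : A),
      SpecialLinearGroup.transvection hk c ∈ liftableSubgroup (rowMap α) := by
    intro k hk c
    obtain ⟨e, he, hem⟩ := exists_mem_transvectionGroup_add_smul (A := A) (α (Pi.single k c))
    refine ⟨e, he, fun v ↦ ?_⟩
    rw [vecMul_coeMonoidHom_transvection, hem, rowMap_apply, rowMap_apply]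
    refine Prod.ext (by simp [hk]) ?_
    change α _ + v 0 • α _ = α _
    rw [← map_smul, ← map_add]
    congr 1
    ext l
    by_cases hl : l = k
    · subst hl; simp
    · simp [hl]
  -- The form reading off the `k`-th coordinate exists on `P` only through `β`, and `β ∘ α = s`
  -- forces the factor `s`.
  have hcol : ∀ (k : Fin d) (hk : k.succ ≠ (0 : Fin (d + 1))) (c : A),
      SpecialLinearGroup.transvection hk (s * c) ∈ liftableSubgroup (rowMap α) := by
    intro k hk c
    obtain ⟨e, he, hem⟩ := exists_mem_transvectionGroup_add_apply (c • LinearMap.proj k ∘ₗ β)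
    refine ⟨e, he, fun v ↦ ?_⟩
    rw [vecMul_coeMonoidHom_transvection, hem, rowMap_apply, rowMap_apply]
    refine Prod.ext ?_ ?_
    · simp [hβα]
      ring
    · simp
  rcases Fin.eq_zero_or_eq_succ i with rfl | ⟨k, rfl⟩
  · obtain ⟨l, rfl⟩ := Fin.exists_succ_eq.mpr h.symm
    exact hrow l h _
  · rcases Fin.eq_zero_or_eq_succ j with rfl | ⟨l, rfl⟩
    · exact hcol k h c
    · have hk : k.succ ≠ 0 := Fin.succ_ne_zero k
      have hl : 0 ≠ l.succ := (Fin.succ_ne_zero l).symm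
      have hX := hcol k hk c
      have hY := hrow l hl 1
      have : SpecialLinearGroup.transvection h (s * c) =
          SpecialLinearGroup.transvection hk (s * c) * SpecialLinearGroup.transvection hl 1 *
          (SpecialLinearGroup.transvection hk (s * c))⁻¹ *
          (SpecialLinearGroup.transvection hl 1)⁻¹ := by
        rw [SpecialLinearGroup.transvection_inv, SpecialLinearGroup.transvection_inv]
        apply SpecialLinearGroup.coeMonoidHom_injective
        simp only [map_mul, coeMonoidHom_transvection]
        rw [← Matrix.single_neg, ← Matrix.single_neg, one_add_mul_one_add_mul_one_sub_mul_one_sub,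
          Matrix.single_mul_single_same, mul_one]
        · exact Matrix.single_mul_single_of_ne _ _ _ _ hk.symm _
        · exact Matrix.single_mul_single_of_ne _ _ _ _ hl.symm _
        · exact Matrix.single_mul_single_of_ne _ _ _ _ h.symm _
      rw [this]
      exact mul_mem (mul_mem (mul_mem hX hY) (inv_mem hX)) (inv_mem hY)

theorem apply_mem_Um {M : Type*} [AddCommGroup M] [Module A M] (e : M ≃ₗ[A] M) {m : M}
    (hm : m ∈ Um A M) : e m ∈ Um A M := by
  obtain ⟨φ, hφ⟩ := hm
  exact ⟨φ ∘ₗ e.symm.toLinearMap, by simpa using hφ⟩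

/-- If `P` has rank exceeding `dim A / I`, then every unimodular element of `A ⊕ P` is moved by
`E(A ⊕ P)` to one congruent to `(1, 0)` modulo `I = (r)`. -/
theorem exists_mem_transvectionGroup_apply_eq_one_add [IsNoetherianRing A]
    [Module.Finite A P] [Module.Projective A P] {d : ℕ}
    (hrank : ∀ p : PrimeSpectrum A, Module.rankAtStalk (R := A) P p = d) {r : A}
    (hr : ringKrullDim (A ⧸ Ideal.span {r}) < d) {m : A × P} (hm : m ∈ Um A (A × P)) :
    ∃ e ∈ transvectionGroup A (A × P), ∃ (t : A) (p : P), e m = (1 + r * t, r • p) := by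
  obtain ⟨a, p⟩ := m
  obtain ⟨q, φ, hφ⟩ := exists_dual_apply_add_smul_sub_one_mem hrank hm d le_rfl _ hr
  obtain ⟨t, ht⟩ := Ideal.mem_span_singleton'.mp hφ
  obtain ⟨e₁, he₁, h₁⟩ := exists_mem_transvectionGroup_add_smul (A := A) q
  -- As `φ (p + a • q) ≡ 1` modulo `r`, adding `(1 - a) • φ` makes the first coordinate `1` modulo
  -- `r`; `e₃` then clears the second.
  obtain ⟨e₂, he₂, h₂⟩ := exists_mem_transvectionGroup_add_apply ((1 - a) • φ)
  obtain ⟨e₃, he₃, h₃⟩ := exists_mem_transvectionGroup_add_smul (A := A) (-(p + a • q))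
  have h12 : e₂ (e₁ (a, p)) = (1 + r * ((1 - a) * t), p + a • q) := by
    rw [h₁, h₂]
    refine Prod.ext ?_ rfl
    simp only [LinearMap.smul_apply, smul_eq_mul]
    linear_combination (a - 1) * ht
  refine ⟨e₃ * (e₂ * e₁), mul_mem he₃ (mul_mem he₂ he₁), (1 - a) * t,
    -(((1 - a) * t) • (p + a • q)), ?_⟩
  change e₃ (e₂ (e₁ (a, p))) = _
  rw [h12, h₃]
  refine Prod.ext rfl ?_
  simp only [smul_neg, smul_smul, add_smul (1 : A), one_smul]
  abel

end Product

/-! ### Reduction to the base point and the theorem -/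

theorem exists_mem_transvectionGroup_apply_eq {A : Type u} [CommRing A] [IsNoetherianRing A]
    {d : ℕ} (hd : 2 ≤ d) (hdim : ringKrullDim A = d)
    {P : Type v} [AddCommGroup P] [Module A P] [Module.Finite A P] [Module.Projective A P]
    (hrank : ∀ 𝔭 : PrimeSpectrum A, Module.rankAtStalk (R := A) P 𝔭 = d)
    (hext : ∀ (R : Type u) [CommRing R] [Algebra A R], Module.Finite A R →
      Function.Injective (algebraMap A R) → ElementaryTransitive (d + 1) R)
    {m : A × P} (hm : m ∈ Um A (A × P)) :
    ∃ e ∈ transvectionGroup A (A × P), e m = (1, 0) := by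
  have : Finite (⊥ : Ideal A).minimalPrimes := Ideal.finite_minimalPrimes_of_isNoetherianRing A ⊥
  have : ∀ i : (⊥ : Ideal A).minimalPrimes, i.1.IsPrime := fun i ↦ i.2.1.1
  obtain ⟨s, hs, α, β, hαβ, hβα⟩ := exists_forall_notMem_comp_eq_smul_of_rankAtStalk_eq (P := P)
    hrank (fun i : (⊥ : Ideal A).minimalPrimes ↦ i.1)
    (fun i j hji ↦ Subtype.ext (le_antisymm (i.2.2 j.2.1 hji) hji))
  have hlt : ringKrullDim (A ⧸ Ideal.span {s ^ 3}) < d := by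
    refine ringKrullDim_quotient_lt bot_le (fun p hp hle ↦ hs ⟨p, hp⟩
      (hp.1.1.mem_of_pow_mem 3 (hle (Ideal.mem_span_singleton_self _)))) ?_
    rw [ringKrullDim_eq_of_ringEquiv (RingEquiv.quotientBot A), hdim]
    exact_mod_cast Nat.lt_succ_self d
  obtain ⟨e, he, t, p, hem⟩ := exists_mem_transvectionGroup_apply_eq_one_add hrank hlt hm
  -- Why `s ^ 3`: `α ∘ β` consumes one factor in lifting `s ^ 3 • p`, and the remaining `s ^ 2` is
  -- what normality requires.
  let v : Fin (d + 1) → A := Fin.cons (1 + s ^ 3 * t) (s ^ 2 • β p)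
  have hfv : rowMap α v = e m := by
    rw [hem, rowMap_apply]
    refine Prod.ext rfl ?_
    change α (s ^ 2 • β p) = s ^ 3 • p
    rw [map_smul, hαβ, smul_smul, ← pow_succ]
  have hv : v ∈ Um A (Fin (d + 1) → A) := by
    obtain ⟨ψ, hψ⟩ := apply_mem_Um e hm
    exact ⟨ψ ∘ₗ rowMap α, by rw [LinearMap.comp_apply, hfv, hψ]⟩
  have hthird : ∀ i j : Fin (d + 1), ∃ k, k ≠ i ∧ k ≠ j := fun i j ↦ by
    obtain ⟨k, hk⟩ := Finset.exists_mem_notMem_of_card_lt_card (s := {i, j})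
      (t := (Finset.univ : Finset (Fin (d + 1))))
      (Finset.card_le_two.trans_lt (by simpa using hd))
    exact ⟨k, by simpa using hk.2⟩
  have : Module.Finite A (excisionRing (Ideal.span {s ^ 2})) :=
    inferInstanceAs (Module.Finite A (Subalgebra.toSubmodule (excisionRing (Ideal.span {s ^ 2}))))
  obtain ⟨g, hg, hgv⟩ := exists_mem_vecMul_eq_single_of_elementaryTransitive
    (hext (excisionRing (Ideal.span {s ^ 2})) inferInstance
      fun x y hxy ↦ congrArg (fun z ↦ z.1.1) hxy)
    (N := (liftableSubgroup (rowMap α)).normalCore)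
    (fun i j hij c hc ↦ by
      obtain ⟨z, rfl⟩ := Ideal.mem_span_singleton.mp hc
      exact transvection_mem_normalCore
        (fun i j h c ↦ transvection_mem_liftableSubgroup hβα h c) hthird hij z) hv
    (fun i ↦ by
      rw [Ideal.mem_span_singleton]
      refine Fin.cases ?_ (fun k ↦ ?_) i
      · exact ⟨s * t, by simp [v]; ring⟩
      · exact ⟨β p k, by simp [v]⟩)
  obtain ⟨e', he', h'⟩ := Subgroup.normalCore_le _ hg
  refine ⟨e' * e, mul_mem he' he, ?_⟩
  change e' (e m) = _
  rw [← hfv, h', hgv, rowMap_apply]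
  refine Prod.ext (by simp) ?_
  have : (fun i : Fin d ↦ (Pi.single 0 1 : Fin (d + 1) → A) i.succ) = 0 := by
    ext i; simp
  rw [this, map_zero]

theorem theorem1 {A : Type u} [CommRing A] [IsNoetherianRing A] (d : ℕ) (hd : d ≠ 1)
    (hdim : ringKrullDim A = d)
    (P : Type v) [AddCommGroup P] [Module A P] [Module.Finite A P] [Module.Projective A P]
    (hrank : ∀ 𝔭 : PrimeSpectrum A, Module.rankAtStalk (R := A) P 𝔭 = d)
    (hext : ∀ (R : Type u) [CommRing R] [Algebra A R], Module.Finite A R →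
      Function.Injective (algebraMap A R) → ElementaryTransitive (d + 1) R) :
    TransvectionTransitive A (A × P) := by
  intro v hv w hw
  rcases Nat.lt_or_ge d 2 with h | h
  · obtain rfl : d = 0 := by omega
    have : Subsingleton P :=
      Module.rankAtStalk_eq_zero_iff_subsingleton.mp (funext fun p ↦ by simpa using hrank p)
    have hrow : ∀ m ∈ Um A (A × P), (fun _ ↦ m.1 : Fin (0 + 1) → A) ∈ Um A (Fin (0 + 1) → A) := by
      rintro m ⟨φ, hφ⟩
      refine ⟨φ ∘ₗ LinearMap.inl A A P ∘ₗ LinearMap.proj 0, ?_⟩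
      rw [← hφ]
      exact congrArg φ (Prod.ext rfl (Subsingleton.elim _ _))
    obtain ⟨g, -, hg⟩ := hext A inferInstance Function.injective_id _ (hrow v hv) _ (hrow w hw)
    have hg1 : g = 1 := Subsingleton.elim (α := SpecialLinearGroup (Fin 1) A) g 1
    subst hg1
    refine ⟨1, one_mem _, Prod.ext ?_ (Subsingleton.elim _ _)⟩
    have := congrFun ((vecMul_one _).symm.trans hg) 0
    exact this
  · obtain ⟨e, he, hev⟩ := exists_mem_transvectionGroup_apply_eq h hdim hrank hext hv
    obtain ⟨e', he', hew⟩ := exists_mem_transvectionGroup_apply_eq h hdim hrank hext hw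
    refine ⟨e'⁻¹ * e, mul_mem (inv_mem he') he, ?_⟩
    change e'.symm (e v) = w
    rw [hev, ← hew, e'.symm_apply_apply]
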